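/- Two cakes, each of length $1$, are each to be cut into $2$ pieces. A division is a matrix $x=(x_{ij})_{1\le i,j\le 2}$ with $x_{ij}\ge 0$ and $x_{i1}+x_{i2}=1$ for each $i$, where $x_{ij}$ is the length of the $j$-th piece of the $i$-th cake. A piece selection is a choice of one piece from each cake; two piece selections are disjoint if they have no common piece on either cake. There are three players. For each player and each division there is a strict partial order ``better than'' on the four piece selections (preferences may be linked over the two cakes), depending only on that player and the division and not on the choices of the other players. A player prefers a piece selection $s$ in a division $x$ (that is, $s$ is an envy-free piece selection for that player in $x$) if, in $x$, the player does not think that any other piece selection is better than $s$. Assume that every player satisfies: (i) (hungry) in every division, if two piece selections differ at most in the piece selected from one cake, and that piece is empty in the first and nonempty in the second, then the second piece selection is better than the first; (ii) (closed preference sets) if $x^{(n)}\to x$ is a convergent sequence of divisions and the player prefers the piece selection $s$ in every $x^{(n)}$, then the player prefers $s$ in $x$. Then there exist a division $x$, two different players $p\ne q$, and disjoint piece selections $s,t$ such that $p$ prefers $s$ in $x$ and $q$ prefers $t$ in $x$. -/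

import Mathlib

open Filter Topology

/-- The polytope of divisions of `m` cakes of length `1` into `k` pieces each: the entry `x i j` is
the length of the `j`-th piece of the `i`-th cake, so all entries are nonnegative and every row
sums to `1`. -/
def Division (m k : ℕ) : Type :=
  {x : Fin m → Fin k → ℝ // ∀ i, (∀ j, 0 ≤ x i j) ∧ ∑ j, x i j = 1}

/-- The topology of the space of matrices. -/
instance (m k : ℕ) : TopologicalSpace (Division m k) :=
  inferInstanceAs (TopologicalSpace
    {x : Fin m → Fin k → ℝ // ∀ i, (∀ j, 0 ≤ x i j) ∧ ∑ j, x i j = 1})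

/-- A piece selection: a choice of one piece from each cake. -/
abbrev PieceSelection (m k : ℕ) : Type := Fin m → Fin k

/-- Two piece selections are disjoint if they have no common piece on any cake. -/
def DisjointSelections {m k : ℕ} (s t : PieceSelection m k) : Prop := ∀ i, s i ≠ t i

/-- The preferences of a single player: `better x t s` says that, in the division `x`, the player
thinks that the piece selection `t` is (strictly) better than the piece selection `s`.
The preferences may be linked over the cakes. They depend on the division and on the player only,
not on the choices made by other players. -/
abbrev Preference (m k : ℕ) : Type :=
  Division m k → PieceSelection m k → PieceSelection m k → Prop

/-- In the division `x` the player prefers `s`: no other piece selection is thought to be better.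
Such an `s` is an envy-free piece selection for the player. -/
def Prefers {m k : ℕ} (better : Preference m k) (x : Division m k) (s : PieceSelection m k) :
    Prop :=
  ∀ t, t ≠ s → ¬ better x t s

/-- In each division, "better" is a strict partial order on the piece selections. -/
def IsOrderly {m k : ℕ} (better : Preference m k) : Prop :=
  ∀ x, (∀ s, ¬ better x s s) ∧ ∀ r s t, better x r s → better x s t → better x r t

/-- The player is hungry: a nonempty piece of a cake is better than an empty piece of that cake,
the pieces selected in the other cakes being fixed. -/
def IsHungry {m k : ℕ} (better : Preference m k) : Prop :=
  ∀ (x : Division m k) (s t : PieceSelection m k) (i : Fin m),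
    (∀ j, j ≠ i → t j = s j) → x.1 i (s i) = 0 → 0 < x.1 i (t i) → better x t s

/-- Preference sets are closed: a piece selection that is preferred for each term of a convergent
sequence of divisions is preferred in the limiting division. -/
def HasClosedPreferenceSets {m k : ℕ} (better : Preference m k) : Prop :=
  ∀ (s : PieceSelection m k) (u : ℕ → Division m k) (x : Division m k),
    Tendsto u atTop (𝓝 x) → (∀ n, Prefers better (u n) s) → Prefers better x s

/-! Non-disjointness makes the four selections a 4-cycle, disjoint ones being antipodal. If no edge
of a triangulated square had disjoint labels, each triangle would carry at most two labels, so the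
labelling would be a map to a circle with winding number zero along the boundary. Hunger forces
winding number one: `crossing` totals 1 on the left side and 0 on the other three. Giving the
vertices of each triangle to three different players turns a disjoint edge into an approximate
solution; compactness and closedness give an exact one. -/

/-- The signed crossing number of a step between two piece selections of two cakes cut into two
pieces: it counts the oriented passages from `(1, 1)` to `(1, 0)`. -/
def crossing (s t : PieceSelection 2 2) : ℤ :=
  if s 0 = 1 ∧ t 0 = 1 then ((s 1 : ℕ) : ℤ) - ((t 1 : ℕ) : ℤ) else 0

/-- `crossing` is additive on triangles without a disjoint pair. -/
theorem crossing_add_crossing {s t u : PieceSelection 2 2} (hst : ¬ DisjointSelections s t)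
    (htu : ¬ DisjointSelections t u) (hsu : ¬ DisjointSelections s u) :
    crossing s t + crossing t u = crossing s u := by
  unfold DisjointSelections at *
  unfold crossing
  revert s t u
  decide

theorem crossing_eq_zero_of_left {s t : PieceSelection 2 2} (hs : s 0 = 0) :
    crossing s t = 0 := by
  simp [crossing, hs]

theorem crossing_eq_zero_of_snd_eq {s t : PieceSelection 2 2} (h : s 1 = t 1) :
    crossing s t = 0 := by
  simp [crossing, h]

/-- A Sperner-type lemma: if the vertices of the triangulated `N × N` grid are labelled by piece
selections, subject to the boundary condition coming from empty pieces, then some edge of the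
triangulation has disjoint labels. -/
theorem exists_edge_disjointSelections (N : ℕ) (l : ℕ → ℕ → PieceSelection 2 2)
    (left : ∀ j, l 0 j 0 = 1) (right : ∀ j, l N j 0 = 0)
    (bottom : ∀ i, l i 0 1 = 1) (top : ∀ i, l i N 1 = 0) :
    ∃ i j i' j', i ≤ i' ∧ i' ≤ i + 1 ∧ j ≤ j' ∧ j' ≤ j + 1 ∧
      DisjointSelections (l i j) (l i' j') := by
  by_contra! H
  -- Discrete Stokes: `crossing` sums to zero around a strip one cell wide and `J` cells high.
  have column (i : ℕ) : ∀ J, ∑ j ∈ Finset.range J, crossing (l i j) (l i (j + 1)) +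
      crossing (l i J) (l (i + 1) J) = crossing (l i 0) (l (i + 1) 0) +
      ∑ j ∈ Finset.range J, crossing (l (i + 1) j) (l (i + 1) (j + 1)) := by
    intro J
    induction J with
    | zero => simp
    | succ J ih =>
      rw [Finset.sum_range_succ, Finset.sum_range_succ]
      -- The two triangles of a cell share its diagonal, whose crossing cancels.
      have h₁ := crossing_add_crossing (H i J i (J + 1) (by lia) (by lia) (by lia) (by lia))
        (H i (J + 1) (i + 1) (J + 1) (by lia) (by lia) (by lia) (by lia))
        (H i J (i + 1) (J + 1) (by lia) (by lia) (by lia) (by lia))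
      have h₂ := crossing_add_crossing (H i J (i + 1) J (by lia) (by lia) (by lia) (by lia))
        (H (i + 1) J (i + 1) (J + 1) (by lia) (by lia) (by lia) (by lia))
        (H i J (i + 1) (J + 1) (by lia) (by lia) (by lia) (by lia))
      linarith
  have const : ∀ i, ∑ j ∈ Finset.range N, crossing (l i j) (l i (j + 1)) =
      ∑ j ∈ Finset.range N, crossing (l 0 j) (l 0 (j + 1)) := by
    intro i
    induction i with
    | zero => rfl
    | succ i ih =>
      have h := column i N
      rw [crossing_eq_zero_of_snd_eq ((top i).trans (top _).symm),
        crossing_eq_zero_of_snd_eq ((bottom i).trans (bottom _).symm)] at h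
      linarith
  have hN := const N
  rw [Finset.sum_eq_zero fun j _ => crossing_eq_zero_of_left (right j)] at hN
  have h0 : ∑ j ∈ Finset.range N, crossing (l 0 j) (l 0 (j + 1)) = 1 := by
    simp only [crossing, left, and_self, if_true]
    rw [Finset.sum_range_sub', bottom, top]
    simp
  omega

/-- Every orderly player prefers some piece selection in every division. -/
theorem IsOrderly.exists_prefers {m k : ℕ} {better : Preference m (k + 1)}
    (h : IsOrderly better) (x : Division m (k + 1)) : ∃ s, Prefers better x s := by
  have : Std.Irrefl (better x) := ⟨(h x).1⟩
  have : IsTrans _ (better x) := ⟨(h x).2⟩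
  obtain ⟨s, -, hs⟩ := (Finite.wellFounded_of_trans_of_irrefl (better x)).has_min
    Set.univ Set.univ_nonempty
  exact ⟨s, fun t _ => hs t trivial⟩

/-- A hungry player does not prefer a selection containing an empty piece. -/
theorem IsHungry.ne_zero {m k : ℕ} {better : Preference m k} (h : IsHungry better)
    {x : Division m k} {s : PieceSelection m k} (hs : Prefers better x s) (i : Fin m) :
    x.1 i (s i) ≠ 0 := by
  intro h0
  obtain ⟨j, hj⟩ : ∃ j, 0 < x.1 i j := by
    by_contra! H
    have := Finset.sum_nonpos fun j (_ : j ∈ Finset.univ) => H j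
    linarith [(x.2 i).2]
  have hne : Function.update s i j ≠ s := by
    intro he
    have := congrFun he i
    rw [Function.update_self] at this
    rw [this, h0] at hj
    exact hj.false
  exact hs _ hne (h x s _ i (fun k hk => Function.update_of_ne hk _ _) h0 (by simpa using hj))

theorem HasClosedPreferenceSets.isClosed {m k : ℕ} {better : Preference m k}
    (h : HasClosedPreferenceSets better) (s : PieceSelection m k) :
    IsClosed {x | Prefers better x s} := by
  have : FirstCountableTopology (Division m k) :=
    inferInstanceAs (FirstCountableTopology
      {x : Fin m → Fin k → ℝ // ∀ i, (∀ j, 0 ≤ x i j) ∧ ∑ j, x i j = 1})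
  exact IsSeqClosed.isClosed fun u x hu hx => h s u x hx hu

/-- The division of two cakes into two pieces with prescribed lengths of the first pieces. -/
def divisionOfFirst (c : unitInterval × unitInterval) : Division 2 2 :=
  ⟨![![c.1, 1 - c.1], ![c.2, 1 - c.2]], by
    have h₁ := c.1.2
    have h₂ := c.2.2
    intro i
    fin_cases i <;> simp [Fin.forall_fin_two, h₁.1, h₁.2, h₂.1, h₂.2]⟩

theorem continuous_divisionOfFirst : Continuous divisionOfFirst := by
  refine Continuous.subtype_mk ?_ _
  refine continuous_pi fun i => continuous_pi fun j => ?_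
  fin_cases i <;> fin_cases j <;> simp <;> fun_prop

/-- The grid point `(i / N, j / N)` of the unit square, for `i, j ≤ N`. -/
noncomputable def gridPoint (N i j : ℕ) : unitInterval × unitInterval :=
  (Set.projIcc 0 1 zero_le_one ((i : ℝ) / N), Set.projIcc 0 1 zero_le_one ((j : ℝ) / N))

theorem dist_gridPoint_le (N : ℕ) {i j i' j' : ℕ} (hi : i ≤ i') (hi' : i' ≤ i + 1)
    (hj : j ≤ j') (hj' : j' ≤ j + 1) :
    dist (gridPoint N i j) (gridPoint N i' j') ≤ 1 / N := by
  have key {a b : ℕ} (h : a ≤ b) (h' : b ≤ a + 1) :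
      dist (Set.projIcc (0 : ℝ) 1 zero_le_one ((a : ℝ) / N))
        (Set.projIcc (0 : ℝ) 1 zero_le_one ((b : ℝ) / N)) ≤ 1 / N := by
    refine ((LipschitzWith.projIcc zero_le_one).dist_le_mul _ _).trans ?_
    rw [NNReal.coe_one, one_mul, Real.dist_eq, ← sub_div, abs_div, Nat.abs_cast]
    have h₁ : (a : ℝ) ≤ b := by exact_mod_cast h
    have h₂ : (b : ℝ) ≤ a + 1 := by exact_mod_cast h'
    gcongr
    rw [abs_le]
    constructor <;> linarith
  rw [Prod.dist_eq]
  exact max_le (key hi hi') (key hj hj')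

/-- On an arbitrarily fine grid there are neighbouring divisions in which two different players
prefer disjoint piece selections. -/
theorem exists_near_disjoint_prefers (better : Fin 3 → Preference 2 2)
    (orderly : ∀ p, IsOrderly (better p)) (hungry : ∀ p, IsHungry (better p))
    {N : ℕ} (hN : N ≠ 0) :
    ∃ c d : unitInterval × unitInterval, dist c d ≤ 1 / N ∧
      ∃ (p q : Fin 3) (s t : PieceSelection 2 2), (p ≠ q ∧ DisjointSelections s t) ∧
        Prefers (better p) (divisionOfFirst c) s ∧ Prefers (better q) (divisionOfFirst d) t := by
  -- Edges raise `i + j` by 1 or 2, so their endpoints have different owners.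
  let owner (i j : ℕ) : Fin 3 := Fin.ofNat 3 (i + j)
  choose l hl using fun i j : ℕ =>
    (orderly (owner i j)).exists_prefers (divisionOfFirst (gridPoint N i j))
  have hne (i j : ℕ) := (hungry (owner i j)).ne_zero (hl i j)
  have hN' : (N : ℝ) ≠ 0 := by exact_mod_cast hN
  have eq_one {a : Fin 2} (h : a ≠ 0) : a = 1 := by omega
  have eq_zero {a : Fin 2} (h : a ≠ 1) : a = 0 := by omega
  obtain ⟨i, j, i', j', hi, hi', hj, hj', hd⟩ := exists_edge_disjointSelections N l
    (fun j => eq_one fun h => hne 0 j 0 (by rw [h]; simp [divisionOfFirst, gridPoint]))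
    (fun j => eq_zero fun h => hne N j 0 (by rw [h]; simp [divisionOfFirst, gridPoint, hN']))
    (fun i => eq_one fun h => hne i 0 1 (by rw [h]; simp [divisionOfFirst, gridPoint]))
    (fun i => eq_zero fun h => hne i N 1 (by rw [h]; simp [divisionOfFirst, gridPoint, hN']))
  refine ⟨_, _, dist_gridPoint_le N hi hi' hj hj', owner i j, owner i' j', l i j, l i' j',
    ⟨fun h => ?_, hd⟩, hl i j, hl i' j'⟩
  -- Equal owners force equal vertices, and no selection is disjoint from itself.
  have h3 : (i + j) % 3 = (i' + j') % 3 := congrArg Fin.val h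
  obtain rfl : i' = i := by omega
  obtain rfl : j' = j := by omega
  exact hd 0 rfl

theorem theorem4 (better : Fin 3 → Preference 2 2)
    (orderly : ∀ p, IsOrderly (better p))
    (hungry : ∀ p, IsHungry (better p))
    (closed : ∀ p, HasClosedPreferenceSets (better p)) :
    ∃ (x : Division 2 2) (p q : Fin 3) (s t : PieceSelection 2 2),
      p ≠ q ∧ DisjointSelections s t ∧ Prefers (better p) x s ∧ Prefers (better q) x t := by
  choose c d hcd h using fun n : ℕ =>
    exists_near_disjoint_prefers better orderly hungry n.succ_ne_zero
  obtain ⟨z, φ, hφ, hc⟩ := CompactSpace.tendsto_subseq c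
  have hdist : Tendsto (fun n => dist (c n) (d n)) atTop (𝓝 0) :=
    squeeze_zero (fun _ => dist_nonneg) hcd
      (by simpa using tendsto_one_div_add_atTop_nhds_zero_nat (𝕜 := ℝ))
  have hd : Tendsto (d ∘ φ) atTop (𝓝 z) :=
    hc.congr_dist (hdist.comp hφ.tendsto_atTop)
  -- There are finitely many choices of `p, q, s, t`, so this is a finite union of closed sets and
  -- contains the limit `(z, z)`.
  have hclosed : IsClosed {w : (unitInterval × unitInterval) × (unitInterval × unitInterval) |
      ∃ (p q : Fin 3) (s t : PieceSelection 2 2), (p ≠ q ∧ DisjointSelections s t) ∧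
        Prefers (better p) (divisionOfFirst w.1) s ∧
        Prefers (better q) (divisionOfFirst w.2) t} := by
    simp only [Set.ofPred_exists]
    refine isClosed_iUnion_of_finite fun p => isClosed_iUnion_of_finite fun q =>
      isClosed_iUnion_of_finite fun s => isClosed_iUnion_of_finite fun t => ?_
    refine isClosed_const.inter (IsClosed.inter ?_ ?_)
    · exact ((closed p).isClosed s).preimage (continuous_divisionOfFirst.comp continuous_fst)
    · exact ((closed q).isClosed t).preimage (continuous_divisionOfFirst.comp continuous_snd)
  obtain ⟨p, q, s, t, ⟨hpq, hst⟩, hs, ht⟩ :=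
    hclosed.mem_of_tendsto (hc.prodMk_nhds hd) (.of_forall fun n => h (φ n))
  exact ⟨divisionOfFirst z, p, q, s, t, hpq, hst, hs, ht⟩
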